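/- **Definitions.** A *Mealy automaton* $(A,\Sigma,\delta,\sigma)$ consists of a finite set $A$ of states, a finite alphabet $\Sigma$, and maps $\delta\colon A\times\Sigma\to A$ and $\sigma\colon A\times\Sigma\to\Sigma$. Each $p\in A$ acts on the set $\Sigma^*$ of finite words by $\sigma_p(x\boldsymbol{w})=\sigma(p,x)\,\sigma_{\delta(p,x)}(\boldsymbol{w})$, with the empty word fixed. If all the maps $\sigma_p$ are bijective, the group of permutations of $\Sigma^*$ generated by them is the *automaton group* generated by the automaton. Let $G$ be a finitely generated group, and let $[g,h]=g^{-1}h^{-1}gh$. The *order problem* (respectively the *Engel problem*) is *undecidable* in $G$ if, for every finite set $S$ of elements such that every element of $G$ is represented by a word in $S^*$ (for instance a finite symmetric generating set), no algorithm decides, given a word in $S^*$, whether it represents an element of finite order (respectively, given two words in $S^*$ representing $g$ and $h$, whether there is an integer $n\ge 1$ such that the $n$-iterated commutator $[\dots[[g,h],h],\dots,h]$ is trivial). A *cellular automaton* is a finite set $T$ with a map $t\colon T^3\to T$, a default state $e\in T$ and a set $F\subseteq T$ of final states. For a finite configuration $\boldsymbol{a}=a_1\dots a_n\in T^*$, put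 $a_0=a_{n+1}=a_{n+2}=e$ and $\tau(\boldsymbol{a})=b_1\dots b_{n+1}$, where $b_k=t(a_{k-1},a_k,a_{k+1})$. The cellular automaton *halts* from $\boldsymbol{a}$ if a symbol of $F$ appears in $\tau^k(\boldsymbol{a})$ for some $k\ge 0$. It is *Turing-universal* if every recursively enumerable set of natural numbers reduces, by a computable map from $\mathbb{N}$ to $T^*$, to the set of configurations from which it halts. Given a cellular automaton $(T,t,e,F)$ and a symbol $\$\notin T$, put $T'=T\cup\{\$\}$. Let $\mathcal{A}(T,t,e,F)$ be the Mealy automaton with alphabet $T'\times\{0,1\}$, whose states are $\neg$, $C_a^b$ for $a\in T$, $b\in T'$, $W_a^b$ for $a,b\in T$, and $P_a$ for $a\in T$. For every letter $x=(c,\varepsilon)$, set $\sigma(p,x)=(c,1-\varepsilon)$ if $p=\neg$ or $p$ is some $C_a^b$, and $\sigma(p,x)=x$ otherwise. The transition map is given by $\delta(p,x)=\neg$ if $p=\neg$ or $x\in F\times\{0,1\}$, and in all other cases by the following rules, where $d\in T$ and $\varepsilon\in\{0,1\}$: - $\delta(C_a^\$,(\$,1))=C_e^\$$ and $\delta(C_a^\$,(\$,0))=C_e^{t(a,e,e)}$;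 - $\delta(C_a^b,(\$,\varepsilon))=\neg$ if $b\ne\$$; - $\delta(C_a^b,(d,1))=C_d^b$ for all $b\in T'$; - $\delta(C_a^b,(d,0))=W_a^b$ if $b=d$, and $\delta(C_a^b,(d,0))=\neg$ if $b\in T'$ and $b\ne d$; - $\delta(W_a^b,(\$,\varepsilon))=C_e^{t(a,b,e)}$ and $\delta(W_a^b,(d,\varepsilon))=P_{t(a,b,d)}$; - $\delta(P_a,(\$,\varepsilon))=C_e^a$ and $\delta(P_a,(d,\varepsilon))=P_a$. **Theorem.** There is a Turing-universal cellular automaton $(T,t,e,F)$ such that all the maps $\sigma_p$ of the Mealy automaton $\mathcal{A}(T,t,e,F)$ are bijective and, in the automaton group $G$ generated by $\mathcal{A}(T,t,e,F)$, both the order problem and the Engel problem are undecidable. In particular, there is an automaton group in which both the order problem and the Engel problem are undecidable. -/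

import Mathlib

/-! ### Mealy automata and automaton groups -/

/-- A Mealy automaton with finite set of states `A` and finite alphabet `X`:
`δ` is the transition map and `σ` the output map. -/
structure MealyAutomaton (A X : Type) [Finite A] [Finite X] where
  δ : A → X → A
  σ : A → X → X

namespace MealyAutomaton

variable {A X : Type} [Finite A] [Finite X]

/-- The action `σ_p` of a state `p` on the set `X*` of all words:
`σ_p(x w) = σ(p, x) σ_{δ(p, x)}(w)`. -/
def act (M : MealyAutomaton A X) : A → List X → List X
  | _, [] => []
  | p, x :: w => M.σ p x :: act M (M.δ p x) w

/-- All the maps `σ_p` are bijective, so that the automaton generates a group. -/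
def IsInvertible (M : MealyAutomaton A X) : Prop :=
  ∀ p : A, Function.Bijective (M.act p)

/-- The group generated by an (invertible) Mealy automaton: the group of permutations of `X*`
generated by all the maps `σ_p`, under composition. -/
def group (M : MealyAutomaton A X) : Subgroup (Equiv.Perm (List X)) :=
  Subgroup.closure {g | ∃ p : A, ⇑g = M.act p}

end MealyAutomaton

/-! ### The order problem and the Engel problem -/

/-- The element of `G` represented by a word in the letters `s 0, …, s (n - 1)`. -/
def wordValue {G : Type} [Group G] {n : ℕ} (s : Fin n → G) (w : List (Fin n)) : G :=
  (w.map s).prod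

/-- The letters `s 0, …, s (n - 1)` generate `G`, in the sense that every element of `G` is
represented by a word in them. For instance, this holds if the letters are the elements of a
generating set of the group `G` together with their inverses. -/
def Generates {G : Type} [Group G] {n : ℕ} (s : Fin n → G) : Prop :=
  ∀ g : G, ∃ w : List (Fin n), wordValue s w = g

/-- The iterated commutator `[…[[g, h], h], …, h]` with `n` commutators,
where `[g, h] = g⁻¹ h⁻¹ g h`. -/
def iteratedCommutator {G : Type} [Group G] (g h : G) : ℕ → G
  | 0 => g
  | n + 1 => (iteratedCommutator g h n)⁻¹ * h⁻¹ * iteratedCommutator g h n * h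

/-- `(g, h)` is an Engel pair. -/
def IsEngelPair {G : Type} [Group G] (g h : G) : Prop :=
  ∃ n : ℕ, 1 ≤ n ∧ iteratedCommutator g h n = 1

/-- The order problem is undecidable in the finitely generated group `G`: whatever the finite
set of generators, no algorithm decides whether a given word represents an element of finite
order. -/
def OrderProblemUndecidable (G : Type) [Group G] : Prop :=
  Group.FG G ∧ ∀ (n : ℕ) (s : Fin n → G), Generates s →
    ¬ ComputablePred fun w : List (Fin n) => IsOfFinOrder (wordValue s w)

/-- The Engel problem is undecidable in the finitely generated group `G`: whatever the finite
set of generators, no algorithm decides whether two given words represent an Engel pair. -/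
def EngelProblemUndecidable (G : Type) [Group G] : Prop :=
  Group.FG G ∧ ∀ (n : ℕ) (s : Fin n → G), Generates s →
    ¬ ComputablePred fun vw : List (Fin n) × List (Fin n) =>
      IsEngelPair (wordValue s vw.1) (wordValue s vw.2)

/-! ### Cellular automata -/

/-- A complete one-dimensional cellular automaton with neighborhood `{-1, 0, 1}`, with set of
states `T`, transition map `t`, default state `e` and set `F` of final states. -/
structure CellularAutomaton (T : Type) where
  t : T → T → T → T
  e : T
  F : Finset T

namespace CellularAutomaton

variable {T : Type}

/-- Update of the cells `a₁ … aₙ` and of one further cell, where `a₀` is the cell on the left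
of `a₁`, and where the cells on the right of `aₙ` are in the default state. -/
def nextAfter (U : CellularAutomaton T) : T → List T → List T
  | a₀, [] => [U.t a₀ U.e U.e]
  | a₀, a₁ :: w => U.t a₀ a₁ (w.headD U.e) :: nextAfter U a₁ w

/-- The updated finite configuration `τ(a₁ … aₙ) = b₁ … bₙ bₙ₊₁`, with
`bₖ = t(aₖ₋₁, aₖ, aₖ₊₁)` and `a₀ = aₙ₊₁ = aₙ₊₂ = e`. -/
def next (U : CellularAutomaton T) (w : List T) : List T :=
  U.nextAfter U.e w

/-- The cellular automaton halts from the finite configuration `w`: a final state appears in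
some `τᵏ(w)`. -/
def Halts (U : CellularAutomaton T) (w : List T) : Prop :=
  ∃ k : ℕ, ∃ f ∈ U.F, f ∈ U.next^[k] w

/-- Turing universality: every recursively enumerable problem reduces, by a computable map from
instances to finite configurations, to the halting problem of the cellular automaton. -/
def IsTuringUniversal {m : ℕ} (U : CellularAutomaton (Fin m)) : Prop :=
  ∀ p : ℕ → Prop, REPred p → ManyOneReducible p U.Halts

/-! ### The Mealy automaton that simulates a cellular automaton -/

/-- The states of the Mealy automaton: `¬`, the states `C_a^b` with `a ∈ T` and `b ∈ T ∪ {$}`,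
the states `W_a^b` with `a, b ∈ T`, and the states `P_a` with `a ∈ T`. The symbol `$` is `none`. -/
inductive SimState (T : Type) where
  | neg : SimState T
  | C : T → Option T → SimState T
  | W : T → T → SimState T
  | P : T → SimState T
deriving DecidableEq, Fintype

/-- The alphabet `(T ∪ {$}) × {0, 1}`, where `0` is `false` and `1` is `true`. -/
abbrev SimLetter (T : Type) : Type := Option T × Bool

/-- The modifying states are `¬` and the states `C_a^b`. -/
def SimState.isModifying : SimState T → Bool
  | .neg => true
  | .C _ _ => true
  | .W _ _ => false
  | .P _ => false

/-- The output map: modifying states exchange `0` and `1` in the second component, the other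
states leave the letter unchanged. -/
def simOutput (p : SimState T) (x : SimLetter T) : SimLetter T :=
  if p.isModifying then (x.1, !x.2) else x

/-- The transition map on letters whose first component is not a final state. -/
def simStep [DecidableEq T] (U : CellularAutomaton T) : SimState T → SimLetter T → SimState T
  | .neg, _ => .neg
  | .C _ none, (none, true) => .C U.e none
  | .C _ (some _), (none, true) => .neg
  | .C a none, (none, false) => .C U.e (some (U.t a U.e U.e))
  | .C _ (some _), (none, false) => .neg
  | .C _ b, (some d, true) => .C d b
  | .C _ none, (some _, false) => .neg
  | .C a (some b), (some d, false) => if b = d then .W a b else .neg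
  | .W a b, (none, _) => .C U.e (some (U.t a b U.e))
  | .W a b, (some d, _) => .P (U.t a b d)
  | .P a, (none, _) => .C U.e (some a)
  | .P a, (some _, _) => .P a

/-- The Mealy automaton that simulates `U`. All states become `¬` when a final state is read. -/
def mealy [Fintype T] [DecidableEq T] (U : CellularAutomaton T) :
    MealyAutomaton (SimState T) (SimLetter T) where
  δ p x := if ∃ f ∈ U.F, x.1 = some f then .neg else U.simStep p x
  σ := simOutput

end CellularAutomaton

/-! A configuration is coded by `row`: the Gray-code product of the states C_e^b of its cells, times
C_e^$. Successive modifying factors see alternating bits, and in the Gray code the state of the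
first unread cell takes every second place. So on a letter with bit 1 this state sees 0 and compares
its cell with the letter, while all the others see 1 and just record the letter. Along the word that
spells the configuration with bits 1, the cells become W, then P, and so compute their updated
values (`partialRow_cons_section_true`). Any other letter brings in ¬, and as conjugation by ¬
inverts Gray products (`neg_conj_gray`), the section squares to 1.

At the end of the row only C_a^$ still flips the bit. The square of the element then has the `row`
of the next configuration as its section at ($,1) (`partialRow_nil_sq_section_true`). Thus each step
doubles the order, whereas a final symbol makes the square trivial; the order is finite exactly when
the automaton halts (`isOfFinOrder_row_iff`).

For the Engel problem, take g = row² and h = ¬. For a nonempty row, g and its conjugate by ¬ have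
disjoint supports (`disjoint_row_sq`), and commutation with an involution amounts to repeated
raising to the power -2. Hence the iterated commutators are trivial exactly when suitable 2-powers
of the row are (`isEngelPair_row_iff`).

A universal cellular automaton comes from a Turing machine for a universal partial recursive
function, simulated step by step on a folded tape (`TM0toCA.halts_cells_iff`). -/

namespace MealyAutomaton

variable {A X : Type} [Finite A] [Finite X]

theorem isInvertible_of_bijective (M : MealyAutomaton A X)
    (h : ∀ p, Function.Bijective (M.σ p)) : M.IsInvertible := by
  intro p
  constructor
  · intro v w hvw
    induction v generalizing p w with
    | nil => cases w <;> simp_all [act]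
    | cons x v ih =>
      cases w with
      | nil => simp [act] at hvw
      | cons y w =>
        simp only [act, List.cons.injEq] at hvw
        obtain rfl := (h p).1 hvw.1
        rw [ih _ hvw.2]
  · intro w
    induction w generalizing p with
    | nil => exact ⟨[], rfl⟩
    | cons y w ih =>
      obtain ⟨x, hx⟩ := (h p).2 y
      obtain ⟨v, hv⟩ := ih (M.δ p x)
      exact ⟨x :: v, by simp [act, hx, hv]⟩

end MealyAutomaton

/-! ### Sections of permutations of words -/

/-- The permutation `g` of words maps `x w` to `y h(w)` for all `w`. -/
def HasSection {X : Type} (g : Equiv.Perm (List X)) (x y : X) (h : Equiv.Perm (List X)) : Prop :=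
  ∀ w, g (x :: w) = y :: h w

namespace HasSection

variable {X : Type} {g h g' h' : Equiv.Perm (List X)} {x y z : X}

theorem one (x : X) : HasSection 1 x x 1 := fun _ => rfl

theorem mul (hg : HasSection g y z g') (hh : HasSection h x y h') :
    HasSection (g * h) x z (g' * h') := fun w => by
  simp [Equiv.Perm.mul_apply, hh w, hg (h' w)]

theorem pow (hg : HasSection g x x h) (n : ℕ) : HasSection (g ^ n) x x (h ^ n) := by
  induction n with
  | zero => simpa using one x
  | succ n ih => rw [pow_succ, pow_succ]; exact ih.mul hg

theorem sq (hg : HasSection g x y g') (hh : HasSection g y x h') :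
    HasSection (g ^ 2) x x (h' * g') := by
  rw [pow_two]; exact hh.mul hg

theorem eq_one (hg : HasSection g x y h) (h1 : g = 1) : h = 1 := by
  subst h1
  ext1 w
  have := hg w
  simp only [Equiv.Perm.coe_one, id_eq, List.cons.injEq] at this
  simp [← this.2]

end HasSection

theorem eq_one_of_hasSection {X : Type} {g : Equiv.Perm (List X)} (h0 : g [] = [])
    (h : ∀ x, HasSection g x x 1) : g = 1 := by
  ext1 w
  cases w with
  | nil => simpa using h0
  | cons x w => simpa using h x w

theorem pow_nil_of_apply {X : Type} {g : Equiv.Perm (List X)} (h0 : g [] = []) (n : ℕ) :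
    (g ^ n) [] = [] := by
  induction n with
  | zero => rfl
  | succ n ih => rw [pow_succ, Equiv.Perm.mul_apply, h0, ih]

/-! ### The permutations defined by the states -/

namespace CellularAutomaton

theorem simOutput_involutive {T : Type} (p : SimState T) : Function.Involutive (simOutput p) := by
  rintro ⟨c, ε⟩
  unfold simOutput
  split_ifs <;> simp

variable {T : Type} [Fintype T] [DecidableEq T] (U : CellularAutomaton T)

theorem mealy_isInvertible : U.mealy.IsInvertible :=
  U.mealy.isInvertible_of_bijective fun p => (simOutput_involutive p).bijective

/-- The permutation of words defined by a state. -/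
noncomputable def perm (p : SimState T) : Equiv.Perm (List (SimLetter T)) :=
  Equiv.ofBijective (U.mealy.act p) (U.mealy_isInvertible p)

@[simp] theorem perm_nil (p : SimState T) : U.perm p [] = [] := rfl

theorem hasSection_perm (p : SimState T) (x : SimLetter T) :
    HasSection (U.perm p) x (simOutput p x) (U.perm (U.mealy.δ p x)) := fun _ => rfl

theorem hasSection_perm_of_modifying {p : SimState T} (hp : p.isModifying = true) (c : Option T)
    (ε : Bool) : HasSection (U.perm p) (c, ε) (c, !ε) (U.perm (U.mealy.δ p (c, ε))) := by
  have := U.hasSection_perm p (c, ε)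
  simpa [simOutput, hp] using this

theorem hasSection_perm_of_not_modifying {p : SimState T} (hp : p.isModifying = false)
    (x : SimLetter T) : HasSection (U.perm p) x x (U.perm (U.mealy.δ p x)) := by
  have := U.hasSection_perm p x
  simpa [simOutput, hp] using this

theorem mealy_δ_of_mem {f : T} (hf : f ∈ U.F) (p : SimState T) (ε : Bool) :
    U.mealy.δ p (some f, ε) = .neg := by
  simp [mealy, hf]

theorem mealy_δ_none (p : SimState T) (ε : Bool) :
    U.mealy.δ p (none, ε) = U.simStep p (none, ε) := by
  simp [mealy]

theorem mealy_δ_of_notMem {d : T} (hd : d ∉ U.F) (p : SimState T) (ε : Bool) :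
    U.mealy.δ p (some d, ε) = U.simStep p (some d, ε) := by
  have : ¬ ∃ f ∈ U.F, (some d : Option T) = some f := by
    rintro ⟨f, hf, h⟩
    cases h
    exact hd hf
  exact if_neg this

@[simp] theorem mealy_δ_neg (x : SimLetter T) : U.mealy.δ .neg x = .neg := by
  simp [mealy, simStep]

/-- W and P ignore the bit, so all their copies in a Gray product keep acting alike although the bit
alternates. -/
theorem mealy_δ_of_not_modifying {p : SimState T} (hp : p.isModifying = false) (c : Option T)
    (ε ε' : Bool) : U.mealy.δ p (c, ε) = U.mealy.δ p (c, ε') := by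
  cases p <;> cases c <;> simp_all [mealy, simStep, SimState.isModifying]

/-- If p is modifying, ¬p fixes each letter; otherwise it swaps two letters at which p has the same
section. Either way the section of the square is again of the form (¬p')². -/
theorem neg_mul_perm_sq (p : SimState T) : (U.perm .neg * U.perm p) ^ 2 = 1 := by
  ext1 w
  rw [pow_two]
  simp only [Equiv.Perm.mul_apply, Equiv.Perm.coe_one, id_eq]
  induction w generalizing p with
  | nil => rfl
  | cons x w ih =>
    obtain ⟨c, ε⟩ := x
    have hn := U.hasSection_perm_of_modifying (p := .neg) rfl c
    simp only [mealy_δ_neg] at hn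
    cases hp : p.isModifying
    · have h := U.hasSection_perm_of_not_modifying hp
      rw [h, hn ε, h, hn, U.mealy_δ_of_not_modifying hp c (!ε) ε, ih]
      simp
    · have h := U.hasSection_perm_of_modifying hp c
      rw [h, hn, Bool.not_not, h, hn, ih]
      simp

theorem perm_neg_sq : U.perm .neg * U.perm .neg = 1 := by
  ext1 w
  simp only [Equiv.Perm.mul_apply, Equiv.Perm.coe_one, id_eq]
  induction w with
  | nil => rfl
  | cons x w ih =>
    obtain ⟨c, ε⟩ := x
    have hn := U.hasSection_perm_of_modifying (p := .neg) rfl c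
    simp only [mealy_δ_neg] at hn
    rw [hn, hn, ih]
    simp

theorem perm_neg_inv : (U.perm .neg)⁻¹ = U.perm .neg :=
  inv_eq_of_mul_eq_one_left U.perm_neg_sq

/-! ### Gray-code products -/

/-- The product of the permutations of a list of states in the order of the Gray code:
the last state of the list comes at every second place. -/
noncomputable def gray : List (SimState T) → Equiv.Perm (List (SimLetter T))
  | [] => 1
  | p :: l => gray l * U.perm p * gray l

theorem gray_nil_apply (l : List (SimState T)) : U.gray l [] = [] := by
  induction l with
  | nil => rfl
  | cons p l ih => simp [gray, ih]

theorem neg_conj_perm (p : SimState T) :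
    U.perm .neg * U.perm p * U.perm .neg = (U.perm p)⁻¹ := by
  have := U.neg_mul_perm_sq p
  rw [pow_two, ← mul_assoc] at this
  exact eq_inv_of_mul_eq_one_left this

/-- A Gray product is a palindrome, so inverting each factor inverts the product. -/
theorem neg_conj_gray (l : List (SimState T)) :
    U.perm .neg * U.gray l * U.perm .neg = (U.gray l)⁻¹ := by
  induction l with
  | nil => simpa [gray] using U.perm_neg_sq
  | cons p l ih =>
    have h2 := U.perm_neg_sq
    calc U.perm .neg * (U.gray l * U.perm p * U.gray l) * U.perm .neg
        = U.perm .neg * U.gray l * (U.perm .neg * U.perm .neg) * U.perm p *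
            (U.perm .neg * U.perm .neg) * U.gray l * U.perm .neg := by
          rw [h2]; simp only [mul_assoc, mul_one]
      _ = (U.perm .neg * U.gray l * U.perm .neg) * (U.perm .neg * U.perm p * U.perm .neg) *
            (U.perm .neg * U.gray l * U.perm .neg) := by simp only [mul_assoc]
      _ = (U.gray l * U.perm p * U.gray l)⁻¹ := by
          rw [ih, neg_conj_perm]; simp only [mul_inv_rev, mul_assoc]

/-- This absorption is how a failed check collapses: a Gray product with ¬ in the middle is just ¬.
-/
theorem gray_mul_neg_mul_gray (l : List (SimState T)) :
    U.gray l * U.perm .neg * U.gray l = U.perm .neg := by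
  have h := U.neg_conj_gray l
  rw [eq_inv_iff_mul_eq_one] at h
  rw [mul_assoc, mul_assoc] at h
  rw [mul_assoc, ← inv_eq_of_mul_eq_one_right h, perm_neg_inv]

theorem gray_neg_cons (l : List (SimState T)) : U.gray (.neg :: l) = U.perm .neg :=
  U.gray_mul_neg_mul_gray l

theorem gray_mul_neg_sq (l : List (SimState T)) : (U.gray l * U.perm .neg) ^ 2 = 1 := by
  rw [pow_two, ← mul_assoc, gray_mul_neg_mul_gray, perm_neg_sq]

theorem hasSection_gray_of_not_modifying {l : List (SimState T)}
    (hl : ∀ p ∈ l, p.isModifying = false) (x : SimLetter T) :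
    HasSection (U.gray l) x x (U.gray (l.map (U.mealy.δ · x))) := by
  induction l with
  | nil => exact HasSection.one x
  | cons p l ih =>
    have ih := ih fun q hq => hl q (by simp [hq])
    exact (ih.mul (U.hasSection_perm_of_not_modifying (hl p (by simp)) x)).mul ih

/-- The last modifying state `j` is every second modifying factor, beginning with the first. So all
copies of `j` see the initial bit, and all states of `A` the opposite one. The number of modifying
factors is odd, hence the flip. -/
theorem hasSection_gray_of_modifying {A I : List (SimState T)} {j : SimState T}
    (hA : ∀ p ∈ A, p.isModifying = true) (hj : j.isModifying = true)
    (hI : ∀ p ∈ I, p.isModifying = false) (c : Option T) (ε : Bool) :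
    HasSection (U.gray (A ++ j :: I)) (c, ε) (c, !ε)
      (U.gray (A.map (U.mealy.δ · (c, !ε)) ++
        U.mealy.δ j (c, ε) :: I.map (U.mealy.δ · (c, ε)))) := by
  induction A with
  | nil =>
    have h1 := U.hasSection_gray_of_not_modifying hI (c, ε)
    have h2 := U.hasSection_gray_of_not_modifying hI (c, !ε)
    have : I.map (U.mealy.δ · (c, !ε)) = I.map (U.mealy.δ · (c, ε)) :=
      List.map_congr_left fun p hp => U.mealy_δ_of_not_modifying (hI p hp) c _ _
    rw [this] at h2
    exact (h2.mul (U.hasSection_perm_of_modifying hj c ε)).mul h1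
  | cons p A ih =>
    have ih := ih fun q hq => hA q (by simp [hq])
    have hp := U.hasSection_perm_of_modifying (hA p (by simp)) c (!ε)
    rw [Bool.not_not] at hp
    exact (ih.mul hp).mul ih

/-! ### Verification of a row, cell by cell -/

/-- The product of the Gray code of a list of states with `C_a^$`. -/
noncomputable def counter (l : List (SimState T)) (a : T) : Equiv.Perm (List (SimLetter T)) :=
  U.gray l * U.perm (.C a none)

/-- The element that represents a configuration in the middle of the verification of a row of the
space-time diagram: `a` is the last cell that was read, `v` are the cells yet to be read, and `I`
are the states of the cells that were read before. -/
noncomputable def partialRow (a : T) (v : List T) (I : List (SimState T)) :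
    Equiv.Perm (List (SimLetter T)) :=
  U.counter ((v.map fun b => SimState.C a (some b)).reverse ++ I) a

/-- The element that represents a configuration. -/
noncomputable def row (w : List T) : Equiv.Perm (List (SimLetter T)) :=
  U.partialRow U.e w []

theorem counter_nil_apply (l : List (SimState T)) (a : T) : U.counter l a [] = [] := by
  simp [counter, gray_nil_apply]

theorem mul_neg_sq_of_gray_neg_cons (l : List (SimState T)) (p : SimState T) :
    (U.gray (.neg :: l) * U.perm p) ^ 2 = 1 := by
  rw [gray_neg_cons, neg_mul_perm_sq]

/-- An element that begins with a modifying state fixes the letters; its sections. -/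
theorem counter_section {A I : List (SimState T)} {j : SimState T} (a : T)
    (hA : ∀ p ∈ A, p.isModifying = true) (hj : j.isModifying = true)
    (hI : ∀ p ∈ I, p.isModifying = false) (c : Option T) (ε : Bool) :
    HasSection (U.counter (A ++ j :: I) a) (c, ε) (c, ε)
      (U.gray (A.map (U.mealy.δ · (c, ε)) ++
        U.mealy.δ j (c, !ε) :: I.map (U.mealy.δ · (c, ε))) *
        U.perm (U.mealy.δ (.C a none) (c, ε))) := by
  have h1 := U.hasSection_perm_of_modifying (p := .C a none) rfl c ε
  have h2 := U.hasSection_gray_of_modifying hA hj hI c (!ε)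
  have : I.map (U.mealy.δ · (c, !ε)) = I.map (U.mealy.δ · (c, ε)) :=
    List.map_congr_left fun p hp => U.mealy_δ_of_not_modifying (hI p hp) c _ _
  rw [Bool.not_not, this] at h2
  exact h2.mul h1

/-- Away from the correct continuation, the sections are involutions. -/
theorem counter_section_sq {a : T} {B : List T} {I : List (SimState T)} {j : SimState T}
    (hj : j = .neg ∨ ∃ b, j = .C a (some b))
    (hI : ∀ p ∈ I, p.isModifying = false) (c : Option T) (ε : Bool)
    (h : ε = false ∨ ∀ d, c = some d → d ∈ U.F) :
    ∃ g, HasSection (U.counter (B.map (fun b => SimState.C a (some b)) ++ j :: I) a) (c, ε) (c, ε) g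
      ∧ g ^ 2 = 1 := by
  refine ⟨_, U.counter_section a (by simp [SimState.isModifying])
    (by rcases hj with rfl | ⟨b, rfl⟩ <;> rfl) hI c ε, ?_⟩
  -- On $ or a final symbol the head of the Gray list, from `B` or `j` itself, turns into ¬ and
  -- absorbs the rest.
  have key : (c = none ∨ ∃ d ∈ U.F, c = some d) →
      (U.gray ((B.map fun b => SimState.C a (some b)).map (U.mealy.δ · (c, ε)) ++
        U.mealy.δ j (c, !ε) :: I.map (U.mealy.δ · (c, ε))) *
        U.perm (U.mealy.δ (.C a none) (c, ε))) ^ 2 = 1 := by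
    intro hc
    have hδ : ∀ b ε, U.mealy.δ (.C a (some b)) (c, ε) = .neg := by
      intro b ε
      rcases hc with rfl | ⟨d, hd, rfl⟩
      · cases ε <;> simp [mealy_δ_none, simStep]
      · exact U.mealy_δ_of_mem hd _ _
    cases B with
    | nil =>
      have : U.mealy.δ j (c, !ε) = .neg := by
        rcases hj with rfl | ⟨b, rfl⟩
        · simp
        · exact hδ b _
      simp only [List.map_nil, List.nil_append, this]
      exact U.mul_neg_sq_of_gray_neg_cons _ _
    | cons b B =>
      simp only [List.map_cons, List.cons_append, hδ b]
      exact U.mul_neg_sq_of_gray_neg_cons _ _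
  cases c with
  | none => exact key (Or.inl rfl)
  | some d =>
    by_cases hd : d ∈ U.F
    · exact key (Or.inr ⟨d, hd, rfl⟩)
    · obtain rfl : ε = false := h.resolve_right fun h => hd (h d rfl)
      -- The bit is 0 here, so C_a^$ itself becomes ¬.
      rw [U.mealy_δ_of_notMem hd (.C a none)]
      exact U.gray_mul_neg_sq _

/-- The states of the cells that were read are `W` or `P`. -/
theorem map_δ_not_modifying {I : List (SimState T)} (hI : ∀ p ∈ I, p.isModifying = false) {d : T}
    (hd : d ∉ U.F) (ε : Bool) :
    ∀ p ∈ I.map (U.mealy.δ · (some d, ε)), p.isModifying = false := by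
  intro p hp
  obtain ⟨q, hq, rfl⟩ := List.mem_map.1 hp
  have := hI q hq
  rw [U.mealy_δ_of_notMem hd]
  cases q <;> simp_all [SimState.isModifying, simStep]

/-- A ¬ in the lowest place stays there: at a letter (d,1) with `d` not final the section has the
same shape with `d` for `a`, and all other sections are involutions already. -/
theorem counter_neg_sq (B : List T) (a : T) {I : List (SimState T)}
    (hI : ∀ p ∈ I, p.isModifying = false) :
    (U.counter (B.map (fun b => SimState.C a (some b)) ++ .neg :: I) a) ^ 2 = 1 := by
  ext1 w
  rw [Equiv.Perm.coe_one, id]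
  induction w generalizing a I with
  | nil => exact pow_nil_of_apply (U.counter_nil_apply _ _) 2
  | cons x w ih =>
    obtain ⟨c, ε⟩ := x
    by_cases h : ε = false ∨ ∀ d, c = some d → d ∈ U.F
    · obtain ⟨g, hg, hg2⟩ := U.counter_section_sq (B := B) (Or.inl rfl) hI c ε h
      rw [hg.pow 2, hg2]
      rfl
    · push Not at h
      obtain ⟨hε, d, rfl, hd⟩ := h
      obtain rfl : ε = true := by simpa using hε
      have hs := U.counter_section (A := B.map fun b => SimState.C a (some b)) (j := .neg) a
        (by simp [SimState.isModifying]) rfl hI (some d) true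
      simp only [List.map_map, U.mealy_δ_of_notMem hd (.C _ _), Function.comp_def, simStep,
        mealy_δ_neg] at hs
      rw [hs.pow 2]
      exact congrArg _ (ih d (U.map_δ_not_modifying hI hd true))

/-- Bit 1 makes the lowest state C_a^b see 0 and check its cell, which succeeds and yields W_a^b;
the other C states see 1 and store `b` as the new left neighbor. -/
theorem partialRow_cons_section_true (a b : T) (v : List T) {I : List (SimState T)}
    (hI : ∀ p ∈ I, p.isModifying = false) (hb : b ∉ U.F) :
    HasSection (U.partialRow a (b :: v) I) (some b, true) (some b, true)
      (U.partialRow b v (.W a b :: I.map (U.mealy.δ · (some b, true)))) := by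
  have hs := U.counter_section (A := v.reverse.map fun b => SimState.C a (some b))
    (j := .C a (some b)) a (by simp [SimState.isModifying]) rfl hI (some b) true
  simp only [List.map_map, U.mealy_δ_of_notMem hb (.C _ _), Function.comp_def, simStep,
    Bool.not_true, if_true] at hs
  simpa [partialRow, counter] using hs

/-- All other sections of an incomplete row are involutions. -/
theorem partialRow_cons_section (a b : T) (v : List T) {I : List (SimState T)}
    (hI : ∀ p ∈ I, p.isModifying = false) (x : SimLetter T) :
    (∃ g, HasSection (U.partialRow a (b :: v) I) x x g ∧ g ^ 2 = 1) ∨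
      b ∉ U.F ∧ x = (some b, true) := by
  obtain ⟨c, ε⟩ := x
  by_cases h : ε = false ∨ ∀ d, c = some d → d ∈ U.F
  · left
    have := U.counter_section_sq (B := v.reverse) (j := .C a (some b)) (a := a)
      (Or.inr ⟨b, rfl⟩) hI c ε h
    simpa [partialRow] using this
  · push Not at h
    obtain ⟨hε, d, rfl, hd⟩ := h
    obtain rfl : ε = true := by simpa using hε
    by_cases hdb : b = d
    · subst hdb
      exact Or.inr ⟨hd, rfl⟩
    · left
      have hs := U.counter_section (A := v.reverse.map fun b => SimState.C a (some b))
        (j := .C a (some b)) a (by simp [SimState.isModifying]) rfl hI (some d) true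
      simp only [List.map_map, U.mealy_δ_of_notMem hd (.C _ _), Function.comp_def, simStep,
        Bool.not_true, if_neg hdb] at hs
      -- The letter differs from the cell, so the lowest C state has become ¬.
      exact ⟨_, by simpa [partialRow, counter] using hs,
        U.counter_neg_sq v.reverse d (U.map_δ_not_modifying hI hd true)⟩

/-! ### The end of a row and the updated configuration -/

/-- The updated value of a cell, given the letter on its right. -/
def newCell (d : Option T) : SimState T → T
  | .W a b => U.t a b (d.getD U.e)
  | .P a => a
  | _ => U.e

/-- The updated configuration, which a partially verified row determines. -/
def newRow (a : T) (v : List T) (I : List (SimState T)) : List T :=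
  (I.map (U.newCell v.head?)).reverse ++ U.nextAfter a v

/-- The updated row is an invariant of the verification: W_a^b waits for its right neighbor, which
`v.head?` supplies, and P_a already holds its final value. -/
theorem newRow_cons (a b : T) (v : List T) {I : List (SimState T)}
    (hI : ∀ p ∈ I, p.isModifying = false) (hb : b ∉ U.F) :
    U.newRow b v (.W a b :: I.map (U.mealy.δ · (some b, true))) = U.newRow a (b :: v) I := by
  have h : ∀ p ∈ I, U.newCell v.head? (U.mealy.δ p (some b, true)) = U.newCell (some b) p := by
    intro p hp
    have := hI p hp
    rw [U.mealy_δ_of_notMem hb]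
    cases p <;> simp_all [SimState.isModifying, simStep, newCell]
  have h' := List.map_congr_left h
  cases v <;> simp_all [newRow, nextAfter, newCell, Function.comp_def]

theorem mul_pow_eq_one_comm {G : Type*} [Group G] {a b : G} {n : ℕ} (h : (a * b) ^ n = 1) :
    (b * a) ^ n = 1 := by
  have : b * a = b * (a * b) * b⁻¹ := by group
  rw [this, conj_pow, h]
  group

section RowEnd

variable {U} {a : T} {I : List (SimState T)} (hI : ∀ p ∈ I, p.isModifying = false)
include hI

theorem partialRow_nil_section (c : Option T) (ε : Bool) :
    HasSection (U.partialRow a [] I) (c, ε) (c, !ε)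
      (U.gray (I.map (U.mealy.δ · (c, ε))) * U.perm (U.mealy.δ (.C a none) (c, ε))) := by
  have h1 := U.hasSection_perm_of_modifying (p := .C a none) rfl c ε
  have h2 := U.hasSection_gray_of_not_modifying hI (c, !ε)
  have : I.map (U.mealy.δ · (c, !ε)) = I.map (U.mealy.δ · (c, ε)) :=
    List.map_congr_left fun p hp => U.mealy_δ_of_not_modifying (hI p hp) c _ _
  rw [this] at h2
  exact h2.mul h1

theorem partialRow_nil_sq_section (c : Option T) (ε : Bool) :
    HasSection (U.partialRow a [] I ^ 2) (c, ε) (c, ε)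
      (U.gray (I.map (U.mealy.δ · (c, ε))) * U.perm (U.mealy.δ (.C a none) (c, !ε)) *
        (U.gray (I.map (U.mealy.δ · (c, ε))) * U.perm (U.mealy.δ (.C a none) (c, ε)))) := by
  have h1 := partialRow_nil_section hI (U := U) (a := a) c ε
  have h2 := partialRow_nil_section hI (U := U) (a := a) c (!ε)
  have : I.map (U.mealy.δ · (c, !ε)) = I.map (U.mealy.δ · (c, ε)) :=
    List.map_congr_left fun p hp => U.mealy_δ_of_not_modifying (hI p hp) c _ _
  rw [this, Bool.not_not] at h2
  exact h1.sq h2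

/-- In the square, C_a^$ sees both bits and becomes C_e^$ and C_e^{t(a,e,e)}. The latter stands
between two copies of a Gray product, hence is its new head: the additional last cell. -/
theorem partialRow_nil_sq_section_true :
    HasSection (U.partialRow a [] I ^ 2) (none, true) (none, true) (U.row (U.newRow a [] I)) := by
  have h := partialRow_nil_sq_section hI (U := U) (a := a) none true
  have hm : I.map (U.mealy.δ · (none, true)) =
      I.map fun p => SimState.C U.e (some (U.newCell none p)) := by
    refine List.map_congr_left fun p hp => ?_
    have := hI p hp
    rw [mealy_δ_none]
    cases p <;> simp_all [SimState.isModifying, simStep, newCell]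
  rw [hm] at h
  simpa [row, partialRow, counter, newRow, nextAfter, gray, mealy_δ_none, simStep, mul_assoc,
    Function.comp_def] using h

/-- At ($,0) the section is a cyclic rotation of the one at ($,1). At all other letters it is, up to
rotation, of the form ¬p, and only these need `k` to be even. -/
theorem partialRow_nil_sq_section_pow {k : ℕ} (hk : Even k)
    (h : U.row (U.newRow a [] I) ^ k = 1) (x : SimLetter T) :
    HasSection ((U.partialRow a [] I ^ 2) ^ k) x x 1 := by
  obtain ⟨c, ε⟩ := x
  have hs := partialRow_nil_sq_section hI (U := U) (a := a) c ε
  suffices hq : ∀ g, HasSection (U.partialRow a [] I ^ 2) (c, ε) (c, ε) g → g ^ k = 1 by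
    rw [← hq _ hs]
    exact hs.pow k
  intro g hg
  -- A section is determined by the permutation and the letter.
  obtain rfl : g = _ := Equiv.ext fun w => (List.cons.inj ((hg w).symm.trans (hs w))).2
  have hconj : ∀ p : SimState T, (U.perm .neg * U.perm p) ^ k = 1 := fun p => by
    obtain ⟨m, rfl⟩ := hk
    rw [← two_mul, pow_mul, neg_mul_perm_sq, one_pow]
  have hcross : ∀ p : SimState T, ∀ l, (U.gray l * U.perm .neg * (U.gray l * U.perm p)) ^ k = 1 :=
    fun p l => by rw [← mul_assoc, gray_mul_neg_mul_gray, hconj]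
  cases c with
  | none =>
    have ht := partialRow_nil_sq_section hI (U := U) (a := a) none true
    have : U.row (U.newRow a [] I) = _ := Equiv.ext fun w =>
      (List.cons.inj ((partialRow_nil_sq_section_true hI w).symm.trans (ht w))).2
    rw [this] at h
    cases ε with
    | true => exact h
    | false =>
      have hm : I.map (U.mealy.δ · (none, true)) = I.map (U.mealy.δ · (none, false)) :=
        List.map_congr_left fun p hp => U.mealy_δ_of_not_modifying (hI p hp) none _ _
      rw [hm] at h
      exact mul_pow_eq_one_comm h
  | some d =>
    by_cases hd : d ∈ U.F
    · simp only [U.mealy_δ_of_mem hd]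
      exact hcross _ _
    · simp only [U.mealy_δ_of_notMem hd (.C _ _)]
      cases ε with
      | true => exact hcross _ _
      | false => exact mul_pow_eq_one_comm (hcross _ _)

theorem partialRow_nil_pow {k : ℕ} (hk : Even k) (h : U.row (U.newRow a [] I) ^ k = 1) :
    U.partialRow a [] I ^ (2 * k) = 1 := by
  rw [pow_mul]
  refine eq_one_of_hasSection ?_ (partialRow_nil_sq_section_pow hI hk h)
  exact pow_nil_of_apply (pow_nil_of_apply (U.counter_nil_apply _ _) 2) k

theorem even_of_partialRow_nil_pow_eq_one {n : ℕ} (h : U.partialRow a [] I ^ n = 1) :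
    ∃ k, n = 2 * k ∧ U.row (U.newRow a [] I) ^ k = 1 := by
  obtain ⟨k, rfl | rfl⟩ := Nat.even_or_odd' n
  · rw [pow_mul] at h
    exact ⟨k, rfl, ((partialRow_nil_sq_section_true hI).pow k).eq_one h⟩
  · exfalso
    -- An odd power flips the bit of the one-letter word ($,0).
    rw [pow_succ, pow_mul] at h
    have h1 := partialRow_nil_section hI (U := U) (a := a) none false
    have h2 := ((partialRow_nil_sq_section hI (U := U) (a := a) none true).pow k).mul h1
    have := h2 []
    rw [h] at this
    simp at this

end RowEnd

/-! ### Orders of rows -/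

theorem partialRow_pow {a : T} {v : List T} {I : List (SimState T)}
    (hI : ∀ p ∈ I, p.isModifying = false) {k : ℕ} (hk : Even k)
    (h : U.row (U.newRow a v I) ^ k = 1) : U.partialRow a v I ^ (2 * k) = 1 := by
  induction v generalizing a I with
  | nil => exact partialRow_nil_pow hI hk h
  | cons b v ih =>
    refine eq_one_of_hasSection (pow_nil_of_apply (U.counter_nil_apply _ _) _) fun x => ?_
    rcases U.partialRow_cons_section a b v hI x with ⟨g, hg, hg2⟩ | ⟨hb, rfl⟩
    · simpa [pow_mul, hg2] using hg.pow (2 * k)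
    · have hs := U.partialRow_cons_section_true a b v hI hb
      have hI' : ∀ p ∈ SimState.W a b :: I.map (U.mealy.δ · (some b, true)),
          p.isModifying = false :=
        List.forall_mem_cons.2 ⟨rfl, U.map_δ_not_modifying hI hb true⟩
      rw [← ih hI' (by rwa [U.newRow_cons a b v hI hb])]
      exact hs.pow _

/-- The only section not known to be an involution reads a correct, nonfinal cell, so following it
leads to the final symbol, where no such section is left. -/
theorem partialRow_sq {a : T} {v : List T} {I : List (SimState T)}
    (hI : ∀ p ∈ I, p.isModifying = false) (h : ∃ f ∈ U.F, f ∈ v) :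
    U.partialRow a v I ^ 2 = 1 := by
  induction v generalizing a I with
  | nil => simp at h
  | cons b v ih =>
    refine eq_one_of_hasSection (pow_nil_of_apply (U.counter_nil_apply _ _) _) fun x => ?_
    rcases U.partialRow_cons_section a b v hI x with ⟨g, hg, hg2⟩ | ⟨hb, rfl⟩
    · simpa [hg2] using hg.pow 2
    · have hs := U.partialRow_cons_section_true a b v hI hb
      have hI' : ∀ p ∈ SimState.W a b :: I.map (U.mealy.δ · (some b, true)),
          p.isModifying = false :=
        List.forall_mem_cons.2 ⟨rfl, U.map_δ_not_modifying hI hb true⟩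
      obtain ⟨f, hf, hfv⟩ := h
      have hfv : f ∈ v := (List.mem_cons.1 hfv).resolve_left fun hfb => hb (hfb ▸ hf)
      rw [← ih hI' ⟨f, hf, hfv⟩]
      exact hs.pow _

theorem exists_of_partialRow_pow_eq_one {a : T} {v : List T} {I : List (SimState T)}
    (hI : ∀ p ∈ I, p.isModifying = false) (hv : ∀ f ∈ U.F, f ∉ v) {n : ℕ}
    (h : U.partialRow a v I ^ n = 1) :
    ∃ k, n = 2 * k ∧ U.row (U.newRow a v I) ^ k = 1 := by
  induction v generalizing a I with
  | nil => exact even_of_partialRow_nil_pow_eq_one hI h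
  | cons b v ih =>
    have hb : b ∉ U.F := fun hb => hv b hb (by simp)
    have hI' : ∀ p ∈ SimState.W a b :: I.map (U.mealy.δ · (some b, true)),
        p.isModifying = false :=
      List.forall_mem_cons.2 ⟨rfl, U.map_δ_not_modifying hI hb true⟩
    have := ih hI' (fun f hf hfv => hv f hf (by simp [hfv]))
      (((U.partialRow_cons_section_true a b v hI hb).pow n).eq_one h)
    rwa [U.newRow_cons a b v hI hb] at this

theorem row_pow_of_next {w : List T} {k : ℕ} (hk : Even k) (h : U.row (U.next w) ^ k = 1) :
    U.row w ^ (2 * k) = 1 :=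
  U.partialRow_pow (by simp) hk h

theorem row_sq {w : List T} (h : ∃ f ∈ U.F, f ∈ w) : U.row w ^ 2 = 1 :=
  U.partialRow_sq (by simp) h

theorem exists_row_pow_of_halts {w : List T} (h : U.Halts w) :
    ∃ k, U.row w ^ 2 ^ (k + 1) = 1 := by
  obtain ⟨n, h⟩ := h
  induction n generalizing w with
  | zero => exact ⟨0, by simpa using U.row_sq h⟩
  | succ n ih =>
    obtain ⟨k, hk⟩ := ih (w := U.next w) (by simpa using h)
    -- The exponent 2^(k+1), never 1, supplies the evenness needed at the row end.
    exact ⟨k + 1, by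
      rw [pow_succ' 2 (k + 1)]
      exact U.row_pow_of_next (by simp [pow_succ]) hk⟩

/-- Without a final symbol the exponent halves when passing to the next configuration, which cannot
go on forever. -/
theorem halts_of_row_pow {w : List T} {n : ℕ} (hn : 0 < n) (h : U.row w ^ n = 1) :
    U.Halts w := by
  induction n using Nat.strong_induction_on generalizing w with
  | _ n ih =>
    by_cases hw : ∃ f ∈ U.F, f ∈ w
    · exact ⟨0, hw⟩
    · push Not at hw
      obtain ⟨k, rfl, hk⟩ := U.exists_of_partialRow_pow_eq_one (by simp) hw h
      obtain ⟨m, hm⟩ := ih k (by omega) (w := U.next w) (by omega) hk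
      exact ⟨m + 1, by simpa using hm⟩

/-- The automaton halts if and only if the element representing the configuration has finite
order. -/
theorem isOfFinOrder_row_iff (w : List T) : IsOfFinOrder (U.row w) ↔ U.Halts w := by
  rw [isOfFinOrder_iff_pow_eq_one]
  constructor
  · rintro ⟨n, hn, h⟩
    exact U.halts_of_row_pow hn h
  · intro h
    obtain ⟨k, hk⟩ := U.exists_row_pow_of_halts h
    exact ⟨_, by positivity, hk⟩

/-! ### Engel pairs -/

/-- Bit 0 excludes the one section that need not be an involution. An empty row would flip the bit
instead. -/
theorem row_sq_apply_of_false {w : List T} (hw : w ≠ []) (c : Option T)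
    (v : List (SimLetter T)) : (U.row w ^ 2) ((c, false) :: v) = (c, false) :: v := by
  obtain ⟨b, w, rfl⟩ := List.exists_cons_of_ne_nil hw
  rcases U.partialRow_cons_section U.e b w (I := []) (by simp) (c, false) with
    ⟨g, hg, hg2⟩ | ⟨-, h⟩
  · rw [row, hg.pow 2, hg2]
    rfl
  · simp at h

/-- The squares of the elements representing configurations and their conjugates by `¬` have
disjoint supports. -/
theorem disjoint_row_sq {w : List T} (hw : w ≠ []) :
    (U.row w ^ 2).Disjoint (U.perm .neg * U.row w ^ 2 * U.perm .neg) := by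
  intro x
  cases x with
  | nil => exact Or.inl (pow_nil_of_apply (U.counter_nil_apply _ _) 2)
  | cons x v =>
    obtain ⟨c, ε⟩ := x
    cases ε with
    | false => exact Or.inl (U.row_sq_apply_of_false hw c v)
    | true =>
      right
      have hn := U.hasSection_perm_of_modifying (p := .neg) rfl c true
      rw [Equiv.Perm.mul_apply, Equiv.Perm.mul_apply, hn, Bool.not_true,
        U.row_sq_apply_of_false hw, ← Bool.not_true, ← hn, ← Equiv.Perm.mul_apply, perm_neg_sq]
      rfl

/-- Commutators with an involution. -/
theorem iteratedCommutator_succ_of_involution {G : Type} [Group G] {g h : G} (hh : h * h = 1)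
    (n : ℕ) : iteratedCommutator g h (n + 1) = (g⁻¹ * (h * g * h)) ^ ((-2 : ℤ) ^ n) := by
  have hi : h⁻¹ = h := inv_eq_of_mul_eq_one_left hh
  induction n with
  | zero => simp [iteratedCommutator, hi, mul_assoc]
  | succ n ih =>
    rw [iteratedCommutator, ih]
    set k := g⁻¹ * (h * g * h) with hk
    have hki : h * k * h⁻¹ = k⁻¹ := by
      rw [hk, hi]
      simp only [mul_inv_rev, inv_inv, hi, mul_assoc, hh, mul_one]
    have : h⁻¹ * k ^ ((-2 : ℤ) ^ n) * h = k ^ (-(-2 : ℤ) ^ n) := by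
      have := conj_zpow (a := h) (b := k) (i := (-2 : ℤ) ^ n)
      rw [hki, inv_zpow, ← zpow_neg] at this
      rw [this, hi]
    rw [mul_assoc, mul_assoc, ← mul_assoc h⁻¹, this, ← zpow_neg, ← zpow_add]
    congr 1
    ring

theorem isEngelPair_row_iff {w : List T} (hw : w ≠ []) :
    IsEngelPair (U.row w ^ 2) (U.perm .neg) ↔ U.Halts w := by
  have hd := U.disjoint_row_sq hw
  -- By disjointness, a power of g⁻¹(¬g¬) is trivial if and only if the same powers of both factors
  -- are, and these are conjugate up to inversion. The square in g = row² shifts the exponent from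
  -- 2^n to 2^(n+1).
  have key : ∀ n : ℕ, iteratedCommutator (U.row w ^ 2) (U.perm .neg) (n + 1) = 1 ↔
      U.row w ^ 2 ^ (n + 1) = 1 := by
    intro n
    have hcomm := hd.commute.inv_left
    rw [iteratedCommutator_succ_of_involution U.perm_neg_sq, hcomm.mul_zpow,
      (((hd.inv_left).zpow_disjoint_zpow _ _).mul_eq_one_iff)]
    have h2 : ((-2 : ℤ) ^ n).natAbs = 2 ^ n := by simp [Int.natAbs_pow]
    have hz : ∀ g : Equiv.Perm (List (SimLetter T)), g ^ ((-2 : ℤ) ^ n) = 1 ↔ g ^ 2 ^ n = 1 := by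
      intro g
      rw [← h2, pow_natAbs_eq_one]
    have hneg : U.perm .neg * U.row w ^ 2 * U.perm .neg =
        U.perm .neg * U.row w ^ 2 * (U.perm .neg)⁻¹ := by rw [perm_neg_inv]
    rw [hz, hz, inv_pow, inv_eq_one, ← pow_mul, ← pow_succ', hneg, conj_pow, conj_eq_one_iff,
      ← pow_mul, ← pow_succ', and_self]
  constructor
  · rintro ⟨n, hn, h⟩
    obtain ⟨n, rfl⟩ := Nat.exists_eq_add_of_le' hn
    exact U.halts_of_row_pow (by positivity) ((key n).1 h)
  · intro h
    obtain ⟨k, hk⟩ := U.exists_row_pow_of_halts h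
    exact ⟨k + 1, by omega, (key k).2 hk⟩

end CellularAutomaton

/-! ### Undecidability by many-one reduction -/

/-- The halting problem, for codes given by natural numbers. -/
theorem exists_rePred_not_computablePred : ∃ p : ℕ → Prop, REPred p ∧ ¬ ComputablePred p := by
  refine ⟨fun n => ((Denumerable.ofNat Nat.Partrec.Code n).eval 0).Dom, ?_, fun h => ?_⟩
  · exact Partrec.comp (ComputablePred.halting_problem_re 0) (Computable.ofNat _)
  · refine ComputablePred.halting_problem 0 ?_
    refine ComputablePred.computable_of_manyOneReducible
      ⟨fun c => Encodable.encode c, Computable.encode, fun c => ?_⟩ h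
    simp

theorem wordValue_append {G : Type} [Group G] {n : ℕ} (s : Fin n → G) (v w : List (Fin n)) :
    wordValue s (v ++ w) = wordValue s v * wordValue s w := by
  simp [wordValue]

namespace CellularAutomaton

variable {T : Type} [Fintype T] [DecidableEq T] (U : CellularAutomaton T)

theorem perm_mem_group (p : SimState T) : U.perm p ∈ U.mealy.group :=
  Subgroup.subset_closure ⟨p, rfl⟩

theorem group_fg : Group.FG U.mealy.group := by
  have : Set.Finite {g : Equiv.Perm (List (SimLetter T)) | ∃ p, ⇑g = U.mealy.act p} := by
    refine (Set.finite_range U.perm).subset ?_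
    rintro g ⟨p, hp⟩
    exact ⟨p, DFunLike.coe_injective hp.symm⟩
  have := this.to_subtype
  exact Group.closure_finite_fg _

/-- A word for the element representing a configuration, given words for the states. -/
def rowWord {A : Type} (wd : T → List A) (last : List A) (w : List T) : List A :=
  w.reverse.foldr (fun b v => v ++ (wd b ++ v)) [] ++ last

theorem computable_rowWord {T A : Type} [Primcodable T] [Finite T] [Primcodable A]
    (wd : T → List A) (last : List A) : Computable (rowWord wd last) := by
  refine Primrec.to_comp ?_
  have h1 : Primrec fun x : List T × T × List A => x.2.2 := Primrec.snd.comp Primrec.snd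
  have h2 : Primrec fun x : List T × T × List A => wd x.2.1 :=
    (Primrec.dom_finite wd).comp (Primrec.fst.comp Primrec.snd)
  have h3 := Primrec.list_foldr (Primrec.list_reverse (α := T)) (Primrec.const ([] : List A))
    (Primrec.list_append.comp h1 (Primrec.list_append.comp h2 h1)).to₂
  exact Primrec.list_append.comp h3 (Primrec.const last)

theorem coe_wordValue_rowWord {n : ℕ} {s : Fin n → U.mealy.group} {wd : T → List (Fin n)}
    {last : List (Fin n)} (hwd : ∀ b,
      ((wordValue s (wd b) : U.mealy.group) : Equiv.Perm (List (SimLetter T))) =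
      U.perm (.C U.e (some b)))
    (hlast : ((wordValue s last : U.mealy.group) : Equiv.Perm (List (SimLetter T))) =
      U.perm (.C U.e none))
    (w : List T) :
    ((wordValue s (rowWord wd last w) : U.mealy.group) : Equiv.Perm (List (SimLetter T))) =
      U.row w := by
  have h : ∀ l : List T, ((wordValue s (l.foldr (fun b v => v ++ (wd b ++ v)) []) : U.mealy.group) :
      Equiv.Perm (List (SimLetter T))) = U.gray (l.map fun b => .C U.e (some b)) := by
    intro l
    induction l with
    | nil => rfl
    | cons b l ih => simp [wordValue_append, gray, ih, hwd, mul_assoc]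
  rw [rowWord, wordValue_append, Subgroup.coe_mul, h, hlast, List.map_reverse]
  simp [row, partialRow, counter]

/-- The words depend only on the finitely many states, so choosing them noneffectively does not harm
the computability of the reduction. -/
theorem exists_words {n : ℕ} {s : Fin n → U.mealy.group} (hs : Generates s) :
    ∃ wd : SimState T → List (Fin n), ∀ p,
      ((wordValue s (wd p) : U.mealy.group) : Equiv.Perm (List (SimLetter T))) = U.perm p := by
  choose wd hwd using fun p => hs ⟨U.perm p, U.perm_mem_group p⟩
  exact ⟨wd, fun p => by rw [hwd]⟩

theorem iteratedCommutator_coe {G : Type} [Group G] {H : Subgroup G} (g h : H) (n : ℕ) :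
    ((iteratedCommutator g h n : H) : G) = iteratedCommutator (g : G) (h : G) n := by
  induction n with
  | zero => rfl
  | succ n ih => simp [iteratedCommutator, ih]

theorem isEngelPair_coe {G : Type} [Group G] {H : Subgroup G} (g h : H) :
    IsEngelPair (g : G) (h : G) ↔ IsEngelPair g h := by
  simp only [IsEngelPair, ← iteratedCommutator_coe, OneMemClass.coe_eq_one]

end CellularAutomaton

section Undecidable

variable {m : ℕ} (U : CellularAutomaton (Fin m)) {p : ℕ → Prop} (hp : ¬ ComputablePred p)
  {f : ℕ → List (Fin m)} (hf : Computable f) (hpf : ∀ n, p n ↔ U.Halts (f n))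
include hp hf hpf

theorem CellularAutomaton.orderProblemUndecidable : OrderProblemUndecidable U.mealy.group := by
  refine ⟨U.group_fg, fun n s hs hc => hp ?_⟩
  obtain ⟨wd, hwd⟩ := U.exists_words hs
  refine ComputablePred.computable_of_manyOneReducible
    ⟨fun k => rowWord (fun b => wd (.C U.e (some b))) (wd (.C U.e none)) (f k),
      (computable_rowWord _ _).comp hf, fun k => ?_⟩ hc
  rw [hpf, ← U.isOfFinOrder_row_iff, ← U.coe_wordValue_rowWord (fun b => hwd _) (hwd _),
    Submonoid.isOfFinOrder_coe]

theorem CellularAutomaton.engelProblemUndecidable (hne : ∀ n, f n ≠ []) :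
    EngelProblemUndecidable U.mealy.group := by
  refine ⟨U.group_fg, fun n s hs hc => hp ?_⟩
  obtain ⟨wd, hwd⟩ := U.exists_words hs
  have hg : Computable fun k =>
      rowWord (fun b => wd (.C U.e (some b))) (wd (.C U.e none)) (f k) :=
    (computable_rowWord _ _).comp hf
  refine ComputablePred.computable_of_manyOneReducible
    ⟨fun k => (rowWord (fun b => wd (.C U.e (some b))) (wd (.C U.e none)) (f k) ++
      rowWord (fun b => wd (.C U.e (some b))) (wd (.C U.e none)) (f k), wd .neg),
      (Computable.list_append.comp hg hg).pair (Computable.const _), fun k => ?_⟩ hc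
  rw [hpf, ← U.isEngelPair_row_iff (hne k), ← CellularAutomaton.isEngelPair_coe,
    wordValue_append, Subgroup.coe_mul, U.coe_wordValue_rowWord (fun b => hwd _) (hwd _), hwd,
    pow_two]

end Undecidable

open Turing

/-! ### Simulation of a Turing machine by a cellular automaton -/

section Simulation

variable {Γ Q : Type}

/-- A cell contains two squares of a two-sided tape that is folded in the middle. It also stores
whether it is the first cell, and possibly the state of the machine, along with the square on
which the head is: `false` stands for the upper half of the tape, which is the right half. -/
abbrev FoldedCell (Γ Q : Type) : Type := Bool × Γ × Γ × Option (Bool × Q)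

namespace FoldedCell

/-- The square on one half of the tape. -/
def square (x : FoldedCell Γ Q) (s : Bool) : Γ := if s then x.2.2.1 else x.2.1

/-- Whether a move on one half of the tape goes away from the fold. -/
def outward : Bool → Dir → Bool
  | false, .left => false
  | false, .right => true
  | true, .left => true
  | true, .right => false

variable [Inhabited Q] (M : TM0.Machine Γ Q)

/-- The instruction that the head executes if it is on the cell. -/
def instruction (x : FoldedCell Γ Q) : Option (Bool × Q × TM0.Stmt Γ) :=
  x.2.2.2.bind fun sq => (M sq.2 (x.square sq.1)).map fun i => (sq.1, i.1, i.2)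

/-- The head after a step in which it remains on the cell. -/
def stay (x : FoldedCell Γ Q) : Option (Bool × Q) :=
  match x.instruction M with
  | some (s, q, .write _) => some (s, q)
  -- An inward move on the first cell crosses the fold: the head stays and changes halves.
  | some (s, q, .move d) => if outward s d then none else if x.1 then some (!s, q) else none
  | none => none

/-- The head after a step in which it moves to the next cell. -/
def out (x : FoldedCell Γ Q) : Option (Bool × Q) :=
  match x.instruction M with
  | some (s, q, .move d) => if outward s d then some (s, q) else none
  | _ => none

/-- The head after a step in which it moves to the previous cell. -/
def back (x : FoldedCell Γ Q) : Option (Bool × Q) :=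
  match x.instruction M with
  | some (s, q, .move d) => if outward s d then none else if x.1 then none else some (s, q)
  | _ => none

/-- The squares of the cell after a step. -/
def written (x : FoldedCell Γ Q) : Γ × Γ :=
  match x.instruction M with
  | some (s, _, .write a) => if s then (x.2.1, a) else (a, x.2.2.1)
  | _ => (x.2.1, x.2.2.1)

variable [Inhabited Γ]

/-- The cell at index `j` if the head is on the square `p` of the tape `h` in the state `q`. -/
def ofTape (q : Q) (p : ℤ) (h : ℤ → Γ) (j : ℕ) : FoldedCell Γ Q :=
  (decide (j = 0), h j, h (-1 - j),
    if p = j then some (false, q) else if p = -1 - j then some (true, q) else none)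

end FoldedCell

variable [Inhabited Q] [Inhabited Γ]

open FoldedCell Classical in
/-- The cellular automaton that simulates a Turing machine. -/
noncomputable def TM0toCA [Fintype Γ] [Fintype Q] (M : TM0.Machine Γ Q) :
    CellularAutomaton (FoldedCell Γ Q) where
  t l x r := (x.1, (x.written M).1, (x.written M).2, ((x.stay M).or (l.out M)).or (r.back M))
  e := (false, default, default, none)
  F := {x | x.2.2.2.isSome ∧ x.instruction M = none}

namespace CellularAutomaton

/-- Treating a finite row as the start of an infinite sequence makes the update rule uniform, with
no special case at the right end. -/
theorem nextAfter_map_range {T : Type} (U : CellularAutomaton T) (a : ℕ → T) (a₀ : T) (n : ℕ)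
    (ha : ∀ j, n ≤ j → a j = U.e) :
    U.nextAfter a₀ ((List.range n).map a) =
      (List.range (n + 1)).map fun j => U.t (j.casesOn a₀ a) (a j) (a (j + 1)) := by
  induction n generalizing a a₀ with
  | zero => simp [nextAfter, ha]
  | succ n ih =>
    rw [List.range_succ_eq_map, List.range_succ_eq_map, List.map_cons, List.map_cons, nextAfter,
      List.map_map, ih (a ∘ Nat.succ) (a 0) fun j hj => ha _ (Nat.succ_le_succ hj), List.map_map]
    congr 1
    · congr 1
      cases n with
      | zero => simp [ha]
      | succ n => simp [List.range_succ_eq_map]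
    · refine List.map_congr_left fun j _ => ?_
      cases j <;> rfl

end CellularAutomaton

namespace TM0toCA

open FoldedCell

/-- The square on which the head is after the execution of a statement. -/
def newPos (p : ℤ) : TM0.Stmt Γ → ℤ
  | .move .left => p - 1
  | .move .right => p + 1
  | .write _ => p

/-- The tape after the execution of a statement. -/
def newTape (p : ℤ) (h : ℤ → Γ) : TM0.Stmt Γ → ℤ → Γ
  | .move _ => h
  | .write a => Function.update h p a

section

omit [Inhabited Γ]

variable {M : TM0.Machine Γ Q} {q q' : Q} {p : ℤ} {h : ℤ → Γ} {i : TM0.Stmt Γ}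

theorem instruction_ofTape (hM : M q (h p) = some (q', i)) (j : ℕ) :
    (ofTape q p h j).instruction M =
      if p = j then some (false, q', i) else if p = -1 - j then some (true, q', i) else none := by
  unfold ofTape instruction
  split_ifs with h1 h2
  · subst h1; simp [square, hM]
  · subst h2; simp [square, hM]
  · rfl

theorem stay_ofTape (hM : M q (h p) = some (q', i)) (j : ℕ) :
    (ofTape q p h j).stay M =
      if p = j ∧ newPos p i = j ∨ p = -1 - j ∧ newPos p i = j then some (false, q')
      else if p = j ∧ newPos p i = -1 - j ∨ p = -1 - j ∧ newPos p i = -1 - j then some (true, q')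
      else none := by
  have h0 : (ofTape q p h j).1 = decide (j = 0) := rfl
  unfold stay
  rw [instruction_ofTape hM, h0]
  rcases i with (_ | _) | a <;> split_ifs <;> simp [newPos, outward] at * <;> omega

theorem out_ofTape (hM : M q (h p) = some (q', i)) (j : ℕ) :
    (ofTape q p h j).out M =
      if p = j ∧ newPos p i = j + 1 then some (false, q')
      else if p = -1 - j ∧ newPos p i = -2 - j then some (true, q') else none := by
  unfold out
  rw [instruction_ofTape hM]
  rcases i with (_ | _) | a <;> split_ifs <;> simp [newPos, outward] at * <;> omega

theorem back_ofTape (hM : M q (h p) = some (q', i)) (j : ℕ) :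
    (ofTape q p h (j + 1)).back M =
      if p = j + 1 ∧ newPos p i = j then some (false, q')
      else if p = -2 - j ∧ newPos p i = -1 - j then some (true, q') else none := by
  have h0 : (ofTape q p h (j + 1)).1 = false := rfl
  unfold back
  rw [instruction_ofTape hM, h0]
  rcases i with (_ | _) | a <;> split_ifs <;> simp [newPos, outward] at * <;> omega

theorem written_ofTape (hM : M q (h p) = some (q', i)) (j : ℕ) :
    (ofTape q p h j).written M = (newTape p h i j, newTape p h i (-1 - j)) := by
  have h1 : (ofTape q p h j).2.1 = h j := rfl
  have h2 : (ofTape q p h j).2.2.1 = h (-1 - j) := rfl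
  unfold written
  rw [instruction_ofTape hM, h1, h2]
  rcases i with d | a
  · split_ifs <;> rfl
  · have h3 : (-1 - j : ℤ) ≠ j := by omega
    split_ifs with h4 h5
    · subst h4; simp [newTape, h3]
    · subst h5; simp [newTape, h3.symm]
    · simp [newTape, Function.update_of_ne, Ne.symm h4, Ne.symm h5]

theorem newPos_cases (p : ℤ) (i : TM0.Stmt Γ) :
    newPos p i = p - 1 ∨ newPos p i = p + 1 ∨ newPos p i = p := by
  rcases i with (_ | _) | a <;> simp [newPos]

end

variable [Fintype Γ] [Fintype Q] {M : TM0.Machine Γ Q} {q q' : Q} {p : ℤ} {h : ℤ → Γ}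
  {i : TM0.Stmt Γ}

theorem t_ofTape (hM : M q (h p) = some (q', i)) (j : ℕ) :
    (TM0toCA M).t (Nat.casesOn j (TM0toCA M).e (ofTape q p h)) (ofTape q p h j)
      (ofTape q p h (j + 1)) = ofTape q' (newPos p i) (newTape p h i) j := by
  have hp := newPos_cases p i
  -- The default cell to the left of cell 0 has no head to send, hence the condition `j ≠ 0`.
  have hout : (Nat.casesOn j (TM0toCA M).e (ofTape q p h) : FoldedCell Γ Q).out M =
      if p + 1 = j ∧ newPos p i = j ∧ j ≠ 0 then some (false, q')
      else if p = -j ∧ newPos p i = -1 - j ∧ j ≠ 0 then some (true, q') else none := by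
    cases j with
    | zero =>
      have : (TM0toCA M).e.out M = none := rfl
      change (TM0toCA M).e.out M = _
      rw [this]
      split_ifs with h1 h2 <;> first | rfl | (exfalso; omega)
    | succ j =>
      change (ofTape q p h j).out M = _
      rw [out_ofTape hM]
      push_cast
      split_ifs <;> first | rfl | (exfalso; omega)
  simp only [TM0toCA] at hout ⊢
  rw [hout, stay_ofTape hM, back_ofTape hM, written_ofTape hM]
  refine Prod.ext rfl (Prod.ext rfl (Prod.ext rfl ?_))
  simp only [ofTape]
  split_ifs <;> first | rfl | (exfalso; omega)

/-- The configuration of the cellular automaton that represents `n` squares on both sides of a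
configuration of the Turing machine. -/
def cells (n : ℕ) (q : Q) (p : ℤ) (h : ℤ → Γ) : List (FoldedCell Γ Q) :=
  (List.range n).map (ofTape q p h)

/-- The head and all nonblank squares are among the `n` squares on each side of the fold. -/
def Bounded (n : ℕ) (p : ℤ) (h : ℤ → Γ) : Prop :=
  -n ≤ p ∧ p < n ∧ ∀ x : ℤ, x < -n ∨ n ≤ x → h x = default

theorem next_cells (hM : M q (h p) = some (q', i)) {n : ℕ} (hb : Bounded n p h) :
    (TM0toCA M).next (cells n q p h) = cells (n + 1) q' (newPos p i) (newTape p h i) := by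
  unfold CellularAutomaton.next cells
  rw [CellularAutomaton.nextAfter_map_range]
  · exact List.map_congr_left fun j _ => t_ofTape hM j
  · intro j hj
    obtain ⟨h1, h2, h3⟩ := hb
    have h4 : p ≠ j := by omega
    have h5 : p ≠ -1 - j := by omega
    -- The head lies within the bounds, so `n` is positive and no cell beyond `n` carries the mark
    -- of the first cell.
    have h6 : j ≠ 0 := by omega
    simp [ofTape, h3 j (by omega), h3 (-1 - j) (by omega), h4, h5, h6, TM0toCA]

omit [Fintype Γ] in
theorem Bounded.step {n : ℕ} (hb : Bounded n p h) (i : TM0.Stmt Γ) :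
    Bounded (n + 1) (newPos p i) (newTape p h i) := by
  obtain ⟨h1, h2, h3⟩ := hb
  have hp := newPos_cases p i
  refine ⟨by push_cast; omega, by push_cast; omega, fun x hx => ?_⟩
  push_cast at hx
  rcases i with d | a
  · exact h3 x (by omega)
  · rw [newTape, Function.update_of_ne (by omega)]
    exact h3 x (by omega)

theorem mem_F {x : FoldedCell Γ Q} :
    x ∈ (TM0toCA M).F ↔ x.2.2.2.isSome ∧ x.instruction M = none := by
  simp [TM0toCA]

theorem exists_final_iff {n : ℕ} (hb : Bounded n p h) :
    (∃ f ∈ (TM0toCA M).F, f ∈ cells n q p h) ↔ M q (h p) = none := by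
  constructor
  · rintro ⟨f, hf, hm⟩
    obtain ⟨j, hj, rfl⟩ := List.mem_map.1 hm
    rw [mem_F] at hf
    cases hM : M q (h p) with
    | none => rfl
    | some qi =>
      obtain ⟨hf1, hf2⟩ := hf
      rw [instruction_ofTape (i := qi.2) (q' := qi.1) hM] at hf2
      simp only [ofTape] at hf1
      split_ifs at hf1 hf2
      simp_all
  · intro hM
    obtain ⟨h1, h2, -⟩ := hb
    rcases lt_or_ge p 0 with hp | hp
    · obtain ⟨j, rfl⟩ : ∃ j : ℕ, p = -1 - j := ⟨(-1 - p).toNat, by omega⟩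
      have : (-1 - j : ℤ) ≠ j := by omega
      refine ⟨_, ?_, List.mem_map.2 ⟨j, List.mem_range.2 (by omega), rfl⟩⟩
      simp [mem_F, ofTape, this, instruction, square, hM]
    · lift p to ℕ using hp
      refine ⟨_, ?_, List.mem_map.2 ⟨p, List.mem_range.2 (by omega), rfl⟩⟩
      simp [mem_F, ofTape, instruction, square, hM]

theorem halts_iff_of_eq_none {n : ℕ} (hb : Bounded n p h) (hM : M q (h p) = none) :
    (TM0toCA M).Halts (cells n q p h) :=
  ⟨0, (exists_final_iff hb).2 hM⟩

/-! ### Turing machine runs in absolute coordinates -/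

/-- The squares of the tape, if the head is on the square `p`. -/
def tapeAt (T : Tape Γ) (p : ℤ) : ℤ → Γ := fun x => T.nth (x - p)

omit [Fintype Γ] [Fintype Q] [Inhabited Q] in
theorem tapeAt_self (T : Tape Γ) (p : ℤ) : tapeAt T p p = T.head := by
  simp [tapeAt]

omit [Fintype Γ] in
-- `Tape` is centered at the head and shifts with each move; the change of `newPos` cancels this
-- shift.
theorem newTape_tapeAt (T : Tape Γ) (p : ℤ) (i : TM0.Stmt Γ) :
    newTape p (tapeAt T p) i = tapeAt (match i with
      | .move d => T.move d
      | .write a => T.write a) (newPos p i) := by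
  funext x
  rcases i with (_ | _) | a
  · simp only [newTape, newPos, tapeAt, Tape.move_left_nth]; congr 1; ring
  · simp only [newTape, newPos, tapeAt, Tape.move_right_nth]; congr 1; ring
  · simp [newTape, newPos, tapeAt, Function.update_apply, sub_eq_zero]

/-- The two machines run in lockstep, and a final symbol is exactly a head without an instruction.
The bound grows by one cell per step, as the configuration does. -/
theorem halts_cells_iff (c : TM0.Cfg Γ Q) (p : ℤ) {n : ℕ} (hb : Bounded n p (tapeAt c.Tape p)) :
    (TM0toCA M).Halts (cells n c.q p (tapeAt c.Tape p)) ↔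
      (StateTransition.eval (TM0.step M) c).Dom := by
  constructor
  · rintro ⟨k, hk⟩
    induction k generalizing c p n with
    | zero =>
      have := (exists_final_iff hb).1 hk
      rw [tapeAt_self] at this
      refine Part.dom_iff_mem.2 ⟨c, StateTransition.mem_eval.2 ⟨.refl, ?_⟩⟩
      simp [TM0.step, this]
    | succ k ih =>
      cases hM : M c.q c.Tape.head with
      | none =>
        refine Part.dom_iff_mem.2 ⟨c, StateTransition.mem_eval.2 ⟨.refl, ?_⟩⟩
        simp [TM0.step, hM]
      | some qi =>
        have hM' : M c.q (tapeAt c.Tape p p) = some (qi.1, qi.2) := by rw [tapeAt_self, hM]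
        have hb' := hb.step qi.2
        rw [Function.iterate_succ_apply, next_cells hM' hb] at hk
        rw [newTape_tapeAt] at hk hb'
        have := ih ⟨qi.1, _⟩ _ hb' hk
        rwa [StateTransition.reaches_eval (Relation.ReflTransGen.single _)]
        simp only [TM0.step, hM]
        rfl
  · intro hd
    obtain ⟨b, hb'⟩ := Part.dom_iff_mem.1 hd
    obtain ⟨hr, hbn⟩ := StateTransition.mem_eval.1 hb'
    clear hb' hd
    induction hr using Relation.ReflTransGen.head_induction_on generalizing p n with
    | refl =>
      refine halts_iff_of_eq_none hb ?_
      rw [tapeAt_self]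
      simpa [TM0.step] using hbn
    | @head c d hcd _ ih =>
      simp only [TM0.step, Option.mem_def, Option.map_eq_some_iff] at hcd
      obtain ⟨qi, hM, rfl⟩ := hcd
      have hM' : M c.q (tapeAt c.Tape p p) = some (qi.1, qi.2) := by rw [tapeAt_self, hM]
      have hb' := hb.step qi.2
      rw [newTape_tapeAt] at hb'
      obtain ⟨k, hk⟩ := ih _ hb'
      refine ⟨k + 1, ?_⟩
      rw [Function.iterate_succ_apply, next_cells hM' hb, newTape_tapeAt]
      exact hk

omit [Fintype Γ] in
theorem mk₁_nth_nat (l : List Γ) (j : ℕ) : (Tape.mk₁ l).nth j = l.getI j := by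
  rw [Tape.mk₁, Tape.mk₂, Tape.mk'_nth_nat, ListBlank.nth_mk]

omit [Fintype Γ] in
theorem mk₁_nth_neg (l : List Γ) {x : ℤ} (hx : x < 0) : (Tape.mk₁ l).nth x = default := by
  obtain ⟨j, rfl⟩ : ∃ j : ℕ, x = -(j + 1 : ℕ) := ⟨(-1 - x).toNat, by omega⟩
  change (Tape.mk₁ l).left.nth j = default
  rw [Tape.mk₁, Tape.mk₂, Tape.mk'_left, ListBlank.nth_mk]
  simp

omit [Fintype Γ] [Fintype Q] [Inhabited Q] in
theorem cells_init (a : Γ) (l : List Γ) (q : Q) :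
    cells (l.length + 1) q 0 (tapeAt (Tape.mk₁ (a :: l)) 0) =
      (true, a, default, some (false, q)) :: l.map fun b => (false, b, default, none) := by
  refine List.ext_getElem (by simp [cells]) fun j h1 h2 => ?_
  have hn : (Tape.mk₁ (a :: l)).nth (-1 - j) = default := mk₁_nth_neg _ (by omega)
  have hz : (0 : ℤ) ≠ -1 - j := by omega
  simp only [cells, List.getElem_map, List.getElem_range, ofTape, tapeAt, sub_zero, hn,
    mk₁_nth_nat, if_neg hz]
  cases j with
  | zero => simp
  | succ j =>
    have h3 : (0 : ℤ) ≠ (j + 1 : ℕ) := by omega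
    simp only [List.length_cons, List.length_map] at h2
    simp only [if_neg h3, List.getElem_cons_succ, List.getElem_map, List.getI_cons_succ,
      List.getI_eq_getElem l (show j < l.length by omega)]
    simp

omit [Fintype Γ] in
theorem bounded_init {l : List Γ} (hl : l ≠ []) :
    Bounded l.length 0 (tapeAt (Tape.mk₁ l) 0) := by
  have := List.length_pos_of_ne_nil hl
  refine ⟨by omega, by omega, fun x hx => ?_⟩
  rw [tapeAt, sub_zero]
  rcases lt_or_ge x 0 with h | h
  · exact mk₁_nth_neg _ h
  · lift x to ℕ using h
    rw [mk₁_nth_nat, List.getI_eq_default _ (by omega)]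

end TM0toCA

end Simulation

/-! ### Renaming of symbols -/

namespace CellularAutomaton

/-- Renaming of the states of a cellular automaton. -/
def congr {T T' : Type} (U : CellularAutomaton T) (σ : T ≃ T') : CellularAutomaton T' where
  t x y z := σ (U.t (σ.symm x) (σ.symm y) (σ.symm z))
  e := σ U.e
  F := U.F.map σ.toEmbedding

theorem congr_nextAfter {T T' : Type} (U : CellularAutomaton T) (σ : T ≃ T') (a : T)
    (w : List T) : (U.congr σ).nextAfter (σ a) (w.map σ) = (U.nextAfter a w).map σ := by
  induction w generalizing a with
  | nil => simp [nextAfter, congr]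
  | cons b w ih =>
    simp only [List.map_cons, nextAfter, ih]
    cases w <;> simp [congr]

theorem congr_next_iterate {T T' : Type} (U : CellularAutomaton T) (σ : T ≃ T') (k : ℕ)
    (w : List T) : (U.congr σ).next^[k] (w.map σ) = (U.next^[k] w).map σ := by
  induction k generalizing w with
  | zero => rfl
  | succ k ih =>
    rw [Function.iterate_succ_apply, Function.iterate_succ_apply, ← ih]
    exact congrArg _ (U.congr_nextAfter σ U.e w)

theorem congr_halts {T T' : Type} (U : CellularAutomaton T) (σ : T ≃ T') (w : List T) :
    (U.congr σ).Halts (w.map σ) ↔ U.Halts w := by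
  simp only [Halts, congr_next_iterate]
  simp [congr]

end CellularAutomaton

/-! ### Restriction of a Turing machine to a set of states -/

section Restrict

variable {Γ Λ : Type} [Inhabited Γ] [Inhabited Λ] (M : TM0.Machine Γ Λ) {S : Set Λ}
  (ss : TM0.Supports M S)

open Classical in
/-- The restriction of a Turing machine to a set of states. -/
noncomputable def restrictStates [Inhabited S] : TM0.Machine Γ S := fun q a =>
  (M q a).bind fun i => if h : i.1 ∈ S then some (⟨i.1, h⟩, i.2) else none

include ss in
-- The set `S` is closed under transitions, so no instruction is lost. The restriction is needed to
-- get a finite set of states, and thus finitely many cells.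
theorem restrictStates_eval_dom [Inhabited S] (q : S) (T : Tape Γ) :
    (StateTransition.eval (TM0.step (restrictStates M (S := S))) ⟨q, T⟩).Dom ↔
      (StateTransition.eval (TM0.step M) ⟨q, T⟩).Dom := by
  refine (StateTransition.tr_eval_dom
    (tr := fun (c : TM0.Cfg Γ S) (d : TM0.Cfg Γ Λ) => (⟨c.q, c.Tape⟩ : TM0.Cfg Γ Λ) = d)
    (StateTransition.fun_respects.2 ?_) rfl).symm
  rintro ⟨q, T⟩
  cases hM : M q T.head with
  | none => simp [StateTransition.FRespects, TM0.step, restrictStates, hM]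
  | some i =>
    have hi : i.1 ∈ S := ss.2 (q' := i.1) (s := i.2) hM q.2
    simp only [StateTransition.FRespects, TM0.step, restrictStates, hM, Option.bind_some,
      dif_pos hi, Option.map_some]
    exact Relation.TransGen.single (by simp [TM0.step, hM])

end Restrict

/-! ### From machines to cellular automata -/

/-- A Turing machine with finitely many states can be simulated by a cellular automaton. -/
theorem exists_cellularAutomaton_of_TM0 {Γ Λ : Type} [Inhabited Γ] [Fintype Γ] [Inhabited Λ]
    (M : TM0.Machine Γ Λ) {S : Set Λ} (hS : S.Finite) (ss : TM0.Supports M S) :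
    ∃ (m : ℕ) (U : CellularAutomaton (Fin m)) (first other : Γ → Fin m),
      ∀ (a : Γ) (l : List Γ), U.Halts (first a :: l.map other) ↔ (TM0.eval M (a :: l)).Dom := by
  let _ : Inhabited S := ⟨⟨default, ss.1⟩⟩
  let _ : Fintype S := hS.fintype
  obtain ⟨m, ⟨e⟩⟩ := Finite.exists_equiv_fin (FoldedCell Γ S)
  refine ⟨m, (TM0toCA (restrictStates M)).congr e,
    fun a => e (true, a, default, some (false, default)),
    fun a => e (false, a, default, none), fun a l => ?_⟩
  have hhalts := TM0toCA.halts_cells_iff (M := restrictStates M (S := S))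
    ⟨default, Tape.mk₁ (a :: l)⟩ 0 (TM0toCA.bounded_init (by simp))
  rw [List.length_cons, TM0toCA.cells_init, restrictStates_eval_dom M ss,
    ← CellularAutomaton.congr_halts _ e, List.map_cons, List.map_map] at hhalts
  exact hhalts

/-- A multi-stack machine can be simulated by a cellular automaton. -/
theorem exists_cellularAutomaton_of_TM2 {K : Type} [DecidableEq K] [Fintype K] {Γ : K → Type}
    [∀ k, Fintype (Γ k)] {Λ σ : Type} [Inhabited Λ] [Inhabited σ] [Fintype σ]
    (M : Λ → TM2.Stmt Γ Λ σ) {S : Finset Λ} (ss : TM2.Supports M S) (k : K) :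
    ∃ (m : ℕ) (U : CellularAutomaton (Fin m)) (first other : Γ k → Fin m),
      ∀ (a : Γ k) (l : List (Γ k)),
        U.Halts (first a :: l.map other) ↔ (TM2.eval M k (l.reverse ++ [a])).Dom := by
  obtain ⟨m, U, first, other, h⟩ := exists_cellularAutomaton_of_TM0 _ (Finset.finite_toSet _)
    (TM1to0.tr_supports _ (TM2to1.tr_supports M ss))
  -- `trInit` writes the reversed input on track `k` and marks only the first square, the bottom of
  -- the stacks, by `true`.
  let γ : Bool → Γ k → TM2to1.Γ' K Γ := fun b a =>
    (b, Function.update (fun _ => none) k (some a))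
  refine ⟨m, U, fun a => first (γ true a), other ∘ γ false, fun a l => ?_⟩
  have hinit : TM2to1.trInit k (l.reverse ++ [a]) = γ true a :: l.map (γ false) := by
    simp only [TM2to1.trInit, List.reverse_append, List.reverse_reverse]
    rfl
  rw [← TM2to1.tr_eval_dom, ← TM1to0.tr_eval, hinit, ← h, List.map_map]

/-! ### A universal cellular automaton -/

section Universal

open PartrecToTM2

/-- A program can be simulated by a cellular automaton. -/
theorem exists_cellularAutomaton_of_code (c : ToPartrec.Code) :
    ∃ (m : ℕ) (U : CellularAutomaton (Fin m)) (first : Fin m) (other : Γ' → Fin m),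
      ∀ n : ℕ, U.Halts (first :: ((trNat n).map other).reverse) ↔ (c.eval [n]).Dom := by
  have : Fintype K' := ⟨{.main, .rev, .aux, .stack}, by rintro (_ | _ | _ | _) <;> simp⟩
  -- `TM2.init` starts at the default label, which therefore has to be the entry point of `c`.
  let _ : Inhabited PartrecToTM2.Λ' := ⟨trNormal c Cont'.halt⟩
  obtain ⟨m, U, first, other, h⟩ :=
    exists_cellularAutomaton_of_TM2 (Γ := fun _ => Γ') (σ := Option Γ') tr
      (tr_supports c Cont'.halt) K'.main
  refine ⟨m, U, first Γ'.cons, other, fun n => ?_⟩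
  have hinit : (TM2.init K'.main (trList [n]) :
      TM2.Cfg (fun _ : K' => Γ') PartrecToTM2.Λ' (Option Γ')) = init c [n] := by
    simp only [TM2.init, init]
    congr 1
    funext k
    cases k <;> rfl
  -- `trList [n]` is `trNat n` followed by `Γ'.cons`, so the first cell does not depend on `n`.
  have := h Γ'.cons (trNat n).reverse
  rw [List.reverse_reverse, List.map_reverse] at this
  rw [this]
  change (StateTransition.eval (TM2.step tr) (TM2.init K'.main (trList [n]))).Dom ↔ _
  rw [hinit, tr_eval]
  rfl

theorem trNat_rec (n : ℕ) (hn : n ≠ 0) :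
    trNat n = (if n % 2 = 1 then Γ'.bit1 else Γ'.bit0) :: trNat (n / 2) := by
  obtain ⟨b, k, rfl⟩ : ∃ b k, n = Nat.bit b k := ⟨_, _, (Nat.bit_bodd_div2 n).symm⟩
  have h : ∀ k : ℕ, trNat k = trNum (Num.ofNat' k) := fun k => by rw [trNat, Num.ofNat'_eq]
  rw [h, h, Num.ofNat'_bit]
  have hk : Nat.bit b k / 2 = k := Nat.bit_div_two b k
  have hk0 : b = false → Num.ofNat' k ≠ 0 := by
    rintro rfl h0
    rw [Num.ofNat'_eq] at h0
    refine hn ?_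
    have : k = 0 := by exact_mod_cast h0
    simp [this]
  rw [hk]
  generalize Num.ofNat' k = x at hk0
  cases b with
  | false =>
    cases x with
    | zero => exact absurd rfl (hk0 rfl)
    | pos x => simp [Nat.bit, trNum, Num.bit0, trPosNum]
  | true => cases x <;> simp [Nat.bit, trNum, Num.bit1, trPosNum]

/-- Course-of-values recursion on the binary digits: `g` receives the list of earlier values, whose
length is `n`, and looks up entry `n / 2`. -/
theorem primrec_map_trNat {m : ℕ} (κ : Γ' → Fin m) : Primrec fun n => (trNat n).map κ := by
  let g : List (List (Fin m)) → Option (List (Fin m)) := fun L =>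
    if L.length = 0 then some []
    else L[L.length / 2]?.map fun l =>
      (if L.length % 2 = 1 then κ Γ'.bit1 else κ Γ'.bit0) :: l
  have hg : Primrec g := by
    have hlen : Primrec fun L : List (List (Fin m)) => L.length := Primrec.list_length
    refine Primrec.ite (Primrec.eq.comp hlen (Primrec.const 0)) (Primrec.const _) ?_
    refine Primrec.option_map (Primrec.list_getElem?.comp Primrec.id
      (Primrec.nat_div.comp hlen (Primrec.const 2))) ?_
    refine Primrec.list_cons.comp₂ ?_ Primrec₂.right
    exact (Primrec.ite (Primrec.eq.comp (Primrec.nat_mod.comp hlen (Primrec.const 2))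
      (Primrec.const 1)) (Primrec.const _) (Primrec.const _)).comp₂ Primrec₂.left
  have : Primrec₂ fun (_ : Unit) n => (trNat n).map κ := by
    refine Primrec.nat_strong_rec _ (g := fun _ => g) (hg.comp Primrec.snd).to₂ fun _ n => ?_
    simp only [g, List.length_map, List.length_range]
    split_ifs with h0 h1
    · simp [h0]
    · rw [trNat_rec n h0, if_pos h1]
      simp [show n / 2 < n by omega]
    · rw [trNat_rec n h0, if_neg h1]
      simp [show n / 2 < n by omega]
  exact this.comp (Primrec.const ()) Primrec.id

/-- Pairing the program with its input leaves one fixed code, hence one cellular automaton for all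
recursively enumerable sets. -/
theorem exists_universal_code : ∃ c : ToPartrec.Code, ∀ (d : Nat.Partrec.Code) (n : ℕ),
    (c.eval [Nat.pair (Encodable.encode d) n]).Dom ↔ (d.eval n).Dom := by
  have h : Partrec fun n : ℕ =>
      (Denumerable.ofNat Nat.Partrec.Code n.unpair.1).eval n.unpair.2 :=
    Nat.Partrec.Code.eval_part.comp
      ((Computable.ofNat _).comp (Computable.fst.comp Computable.unpair))
      (Computable.snd.comp Computable.unpair)
  obtain ⟨c, hc⟩ := ToPartrec.Code.exists_code (Nat.Partrec'.part_iff₁.2 h)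
  refine ⟨c, fun d n => ?_⟩
  have := hc (Nat.pair (Encodable.encode d) n ::ᵥ List.Vector.nil)
  simp only [List.Vector.head_cons, Nat.unpair_pair, Denumerable.ofNat_encode] at this
  change (c.eval (Nat.pair (Encodable.encode d) n ::ᵥ List.Vector.nil).1).Dom ↔ _
  rw [this]
  rfl

/-- There is a Turing-universal cellular automaton. -/
theorem exists_universal_cellularAutomaton : ∃ (m : ℕ) (U : CellularAutomaton (Fin m)),
    ∀ p : ℕ → Prop, REPred p → ∃ f : ℕ → List (Fin m),
      Computable f ∧ (∀ n, f n ≠ []) ∧ ∀ n, p n ↔ U.Halts (f n) := by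
  obtain ⟨c, hc⟩ := exists_universal_code
  obtain ⟨m, U, first, other, hU⟩ := exists_cellularAutomaton_of_code c
  refine ⟨m, U, fun p hp => ?_⟩
  -- Only the domain of this function matters; it is `p`.
  have hp' : Nat.Partrec fun n => (Part.assert (p n) fun _ => Part.some ()).map fun _ => 0 :=
    Partrec.nat_iff.1 (Partrec.map hp (Computable.const 0).to₂)
  obtain ⟨d, hd⟩ := Nat.Partrec.Code.exists_code.1 hp'
  refine ⟨fun n => first :: ((trNat (Nat.pair (Encodable.encode d) n)).map other).reverse,
    ?_, by simp, fun n => ?_⟩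
  · refine Primrec.to_comp ?_
    exact Primrec.list_cons.comp (Primrec.const _) (Primrec.list_reverse.comp
      ((primrec_map_trNat other).comp (Primrec₂.natPair.comp (Primrec.const _) Primrec.id)))
  · rw [hU, hc, hd]
    simp [Part.assert]

end Universal

theorem mainTheorem1 :
    ∃ (m : ℕ) (U : CellularAutomaton (Fin m)),
      U.IsTuringUniversal ∧
      U.mealy.IsInvertible ∧
      OrderProblemUndecidable U.mealy.group ∧
      EngelProblemUndecidable U.mealy.group := by
  obtain ⟨m, U, hU⟩ := exists_universal_cellularAutomaton
  obtain ⟨p, hp, hp'⟩ := exists_rePred_not_computablePred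
  obtain ⟨f, hf, hne, hpf⟩ := hU p hp
  refine ⟨m, U, fun q hq => ?_, U.mealy_isInvertible, U.orderProblemUndecidable hp' hf hpf,
    U.engelProblemUndecidable hp' hf hpf hne⟩
  obtain ⟨g, hg, -, hqg⟩ := hU q hq
  exact ⟨g, hg, hqg⟩
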